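/- For $k\in\mathbb Z_{\ge 0}$ let $(a)_k=a(a+1)\cdots(a+k-1)$ (with $(a)_0=1$), and for real $\alpha,\beta$ let $$P_n^{(\alpha,\beta)}(x)=\sum_{k=0}^{n}\frac{(n+\alpha+\beta+1)_k\,(\alpha+k+1)_{n-k}}{k!\,(n-k)!}\Big(\frac{x-1}{2}\Big)^k$$ be the Jacobi polynomials in their standard normalization $P_n^{(\alpha,\beta)}(1)=(\alpha+1)_n/n!$. Then for every real $\alpha>-1$ and every integer $n\ge 0$ the following integral of Gegenbauer (symmetric Jacobi) polynomials converges absolutely and has the value $$\int_{-1}^{1}\Big(\frac{P_{2n+1}^{(\alpha,\alpha)}(x)}{x}\Big)^2(1-x^2)^{\alpha}\,dx=\frac{2^{2\alpha+1}\,\Gamma(2n+\alpha+2)^2}{\Gamma(2n+2\alpha+2)\,(2n+1)!}.$$ In particular, for every integer $n\ge 0$, with absolutely convergent integrals: * ($\alpha=0$) for the Legendre polynomials $P_n=P_n^{(0,0)}$, $$\int_{-1}^{1}\Big(\frac{P_{2n+1}(x)}{x}\Big)^2dx=2;$$ * ($\alpha=-\tfrac12$) the Chebyshev polynomials of the first kind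 are $T_n=\dfrac{n!}{(1/2)_n}P_n^{(-1/2,-1/2)}$, and $$\int_{-1}^{1}\Big(\frac{T_{2n+1}(x)}{x}\Big)^2(1-x^2)^{-1/2}\,dx=(2n+1)\pi;$$ * ($\alpha=\tfrac12$) the Chebyshev polynomials of the second kind are $U_n=\dfrac{(n+1)!}{(3/2)_n}P_n^{(1/2,1/2)}$, and $$\int_{-1}^{1}\Big(\frac{U_{2n+1}(x)}{x}\Big)^2(1-x^2)^{1/2}\,dx=(2n+2)\pi.$$ -/

import Mathlib

/-- The Pochhammer symbol (rising factorial) `(a)_k = a (a + 1) ⋯ (a + k - 1)`. -/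
noncomputable def poch (a : ℝ) (k : ℕ) : ℝ := (ascPochhammer ℝ k).eval a

/-- The Jacobi polynomial `P_n^{(α, β)}`, in its standard normalization
`P_n^{(α, β)}(1) = (α + 1)_n / n!`:
`P_n^{(α, β)}(x) = ∑_{k ≤ n} (n + α + β + 1)_k (α + k + 1)_{n - k} / (k! (n - k)!) ((x - 1) / 2)^k`,
that is `((α + 1)_n / n!) ₂F₁(-n, n + α + β + 1; α + 1; (1 - x) / 2)`
with the denominators `(α + 1)_k` cleared. -/
noncomputable def jacobi (α β : ℝ) (n : ℕ) : Polynomial ℝ :=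
  ∑ k ∈ Finset.range (n + 1),
    Polynomial.C (poch (n + α + β + 1) k * poch (α + k + 1) (n - k) /
      ((k.factorial : ℝ) * ((n - k).factorial : ℝ))) *
      (Polynomial.C (1 / 2) * (Polynomial.X - 1)) ^ k

/-- The Legendre polynomial `P_n = P_n^{(0, 0)}`. -/
noncomputable def legendre (n : ℕ) : Polynomial ℝ := jacobi 0 0 n

open Polynomial MeasureTheory

/-! Put `Q n = P_{2n+1} / x`, a polynomial of degree at most `2n`, since `P_{2n+1}` vanishes at `0`.
Dividing the three-term recurrence by `x` gives `A Q (n+1) = B P_{2n+2} - C Q n`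
(`oddJacobiDivX_succ`), and the two terms on the right are orthogonal. So Pythagoras gives `A² ‖Q
(n+1)‖² = B² ‖P_{2n+2}‖² + C² ‖Q n‖²`, and the closed form follows by induction from the norms of
the `P_m` (`gegenbauerIntegral_oddJacobiDivX_sq`).

The inputs are classical. The recurrence and the differential equation are coefficient identities in
`t = (x - 1) / 2`; the differential equation and integration by parts give orthogonality; the
recurrence and orthogonality give the norms, starting from the mass of the weight, a beta integral.
The Legendre and Chebyshev cases are the values `α = 0, ∓1/2`, up to normalization. -/

/-! ### The beta integral and the mass of the weight -/

theorem ofReal_beta_integrand {u v x : ℝ} (hx : x ∈ Set.Icc (0 : ℝ) 1) :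
    (x : ℂ) ^ ((u : ℂ) - 1) * (1 - (x : ℂ)) ^ ((v : ℂ) - 1) =
      ((x ^ (u - 1) * (1 - x) ^ (v - 1) : ℝ) : ℂ) := by
  have h : 0 ≤ 1 - x := by linarith [hx.2]
  rw [Complex.ofReal_mul, Complex.ofReal_cpow hx.1, Complex.ofReal_cpow h]
  push_cast
  rfl

theorem intervalIntegrable_beta {u v : ℝ} (hu : 0 < u) (hv : 0 < v) :
    IntervalIntegrable (fun x : ℝ => x ^ (u - 1) * (1 - x) ^ (v - 1)) volume 0 1 := by
  have h := Complex.betaIntegral_convergent (u := u) (v := v) (by simpa) (by simpa)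
  rw [intervalIntegrable_iff_integrableOn_Icc_of_le zero_le_one] at h ⊢
  refine (integrableOn_congr_fun (fun x hx => ?_) measurableSet_Icc).mp h.re
  simp only [ofReal_beta_integrand hx]
  exact Complex.ofReal_re _

theorem integral_beta {u v : ℝ} (hu : 0 < u) (hv : 0 < v) :
    ∫ x in (0 : ℝ)..1, x ^ (u - 1) * (1 - x) ^ (v - 1) =
      Real.Gamma u * Real.Gamma v / Real.Gamma (u + v) := by
  have h : Complex.betaIntegral u v =
      ((∫ x in (0 : ℝ)..1, x ^ (u - 1) * (1 - x) ^ (v - 1) : ℝ) : ℂ) := by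
    rw [Complex.betaIntegral, ← intervalIntegral.integral_ofReal]
    refine intervalIntegral.integral_congr fun x hx => ?_
    rw [Set.uIcc_of_le zero_le_one] at hx
    exact ofReal_beta_integrand hx
  have h2 := ProbabilityTheory.beta_eq_betaIntegralReal u v hu hv
  rw [h, Complex.ofReal_re] at h2
  exact h2.symm

/-- With `u = (x + 1) / 2` one has `1 - x² = 4 u (1 - u)`, which turns the weight into a beta
integrand. -/
theorem one_sub_sq_rpow_eq {α x : ℝ} (hx : x ∈ Set.Icc (-1 : ℝ) 1) :
    (4 : ℝ) ^ α * ((1 / 2 * x + 1 / 2) ^ (α + 1 - 1) * (1 - (1 / 2 * x + 1 / 2)) ^ (α + 1 - 1)) =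
      (1 - x ^ 2) ^ α := by
  have h1 : 0 ≤ 1 / 2 * x + 1 / 2 := by linarith [hx.1]
  have h2 : 0 ≤ 1 - (1 / 2 * x + 1 / 2) := by linarith [hx.2]
  rw [add_sub_cancel_right, ← Real.mul_rpow h1 h2, ← Real.mul_rpow (by norm_num) (mul_nonneg h1 h2)]
  congr 1
  ring

theorem intervalIntegrable_gegenbauerWeight {α : ℝ} (hα : -1 < α) :
    IntervalIntegrable (fun x : ℝ => (1 - x ^ 2) ^ α) volume (-1) 1 := by
  have hp : 0 < α + 1 := by linarith
  have h := ((intervalIntegrable_beta hp hp).comp_add_right (1 / 2)).comp_mul_left (c := 1 / 2)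
  norm_num at h
  rw [intervalIntegrable_iff_integrableOn_Icc_of_le (by norm_num)] at h ⊢
  refine (integrableOn_congr_fun (fun x hx => ?_) measurableSet_Icc).mp (h.const_mul (4 ^ α))
  rw [← one_sub_sq_rpow_eq hx]
  norm_num

theorem integral_gegenbauerWeight {α : ℝ} (hα : -1 < α) :
    ∫ x in (-1 : ℝ)..1, (1 - x ^ 2) ^ α =
      2 ^ (2 * α + 1) * Real.Gamma (α + 1) ^ 2 / Real.Gamma (2 * α + 2) := by
  have hp : 0 < α + 1 := by linarith
  have h := intervalIntegral.integral_comp_mul_add (a := -1) (b := 1)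
    (fun x : ℝ => x ^ (α + 1 - 1) * (1 - x) ^ (α + 1 - 1))
    (c := 1 / 2) (by norm_num) (1 / 2)
  have e1 : (1 / 2 : ℝ) * -1 + 1 / 2 = 0 := by norm_num
  have e2 : (1 / 2 : ℝ) * 1 + 1 / 2 = 1 := by norm_num
  rw [e1, e2, integral_beta hp hp] at h
  have h4 : (2 : ℝ) ^ (2 * α + 1) = 2 * 4 ^ α := by
    rw [Real.rpow_add_one (by norm_num), Real.rpow_mul (by norm_num)]
    norm_num [mul_comm]
  calc ∫ x in (-1 : ℝ)..1, (1 - x ^ 2) ^ α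
      = ∫ x in (-1 : ℝ)..1, 4 ^ α * ((1 / 2 * x + 1 / 2) ^ (α + 1 - 1) *
          (1 - (1 / 2 * x + 1 / 2)) ^ (α + 1 - 1)) := by
        refine intervalIntegral.integral_congr fun x hx => ?_
        rw [Set.uIcc_of_le (by norm_num)] at hx
        exact (one_sub_sq_rpow_eq hx).symm
    _ = _ := by
        rw [intervalIntegral.integral_const_mul, h, h4, smul_eq_mul]
        ring_nf

/-! ### The weighted integral as a linear functional -/

theorem intervalIntegrable_eval_mul_gegenbauerWeight {α : ℝ} (hα : -1 < α) (f : ℝ[X]) :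
    IntervalIntegrable (fun x : ℝ => f.eval x * (1 - x ^ 2) ^ α) volume (-1) 1 :=
  (intervalIntegrable_gegenbauerWeight hα).continuousOn_mul f.continuous.continuousOn

/-- Integration of polynomials over `[-1, 1]` against the Gegenbauer weight `(1 - x ^ 2) ^ α`. -/
noncomputable def gegenbauerIntegral {α : ℝ} (hα : -1 < α) : ℝ[X] →ₗ[ℝ] ℝ where
  toFun f := ∫ x in (-1 : ℝ)..1, f.eval x * (1 - x ^ 2) ^ α
  map_add' f g := by
    simp only [eval_add, add_mul]
    exact intervalIntegral.integral_add (intervalIntegrable_eval_mul_gegenbauerWeight hα f)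
      (intervalIntegrable_eval_mul_gegenbauerWeight hα g)
  map_smul' c f := by
    simp only [eval_smul, smul_eq_mul, mul_assoc, intervalIntegral.integral_const_mul,
      RingHom.id_apply]

theorem gegenbauerIntegral_one {α : ℝ} (hα : -1 < α) :
    gegenbauerIntegral hα 1 =
      2 ^ (2 * α + 1) * Real.Gamma (α + 1) ^ 2 / Real.Gamma (2 * α + 2) := by
  rw [← integral_gegenbauerWeight hα]
  simp [gegenbauerIntegral]

/-- The integrand is the derivative of `(1 - x²)^(α+1) f`, whose boundary values vanish because `α +
1 > 0`. -/
theorem gegenbauerIntegral_byParts {α : ℝ} (hα : -1 < α) (f : ℝ[X]) :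
    gegenbauerIntegral hα ((1 - X ^ 2) * derivative f - C (2 * (α + 1)) * X * f) = 0 := by
  have hp : 0 < α + 1 := by linarith
  have key := intervalIntegral.integral_eq_sub_of_hasDerivAt_of_le (a := -1) (b := 1)
    (f := fun x : ℝ => (1 - x ^ 2) ^ (α + 1) * f.eval x)
    (f' := fun x : ℝ => ((1 - X ^ 2) * derivative f - C (2 * (α + 1)) * X * f).eval x *
      (1 - x ^ 2) ^ α) (by norm_num)
    (((Continuous.rpow_const (by fun_prop) fun _ => Or.inr hp.le).mul f.continuous).continuousOn)
    (fun x hx => by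
      have hpos : 0 < 1 - x ^ 2 := by nlinarith [hx.1, hx.2]
      have h1 : HasDerivAt (fun x : ℝ => 1 - x ^ 2) (-(2 * x)) x := by
        simpa using (hasDerivAt_pow 2 x).const_sub 1
      convert! (h1.rpow_const (p := α + 1) (Or.inl hpos.ne')).mul (f.hasDerivAt x) using 1
      rw [add_sub_cancel_right, Real.rpow_add_one hpos.ne']
      simp
      ring)
    (intervalIntegrable_eval_mul_gegenbauerWeight hα _)
  refine key.trans ?_
  simp [Real.zero_rpow hp.ne']

/-! ### Pochhammer symbols and Jacobi coefficients -/

theorem poch_zero (a : ℝ) : poch a 0 = 1 := by simp [poch]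

theorem poch_succ (a : ℝ) (k : ℕ) : poch a (k + 1) = poch a k * (a + k) :=
  ascPochhammer_succ_eval k a

theorem poch_succ_left (a : ℝ) (k : ℕ) : poch a (k + 1) = a * poch (a + 1) k := by
  simp [poch, ascPochhammer_succ_left, eval_comp]

theorem poch_pos {a : ℝ} (ha : 0 < a) (k : ℕ) : 0 < poch a k := ascPochhammer_pos k a ha

theorem Gamma_add_natCast_eq_poch {a : ℝ} (ha : 0 < a) (k : ℕ) :
    Real.Gamma (a + k) = poch a k * Real.Gamma a := by
  induction k with
  | zero => simp [poch_zero]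
  | succ k ih =>
    rw [poch_succ, Nat.cast_succ, ← add_assoc, Real.Gamma_add_one (by positivity), ih]
    ring

/-- The coefficient of `((x - 1) / 2) ^ k` in `P_n^{(α, β)}`. -/
noncomputable def jacobiCoeff (α β : ℝ) (n k : ℕ) : ℝ :=
  if k ≤ n then poch (n + α + β + 1) k * poch (α + k + 1) (n - k) /
      ((k.factorial : ℝ) * ((n - k).factorial : ℝ)) else 0

/-- The Jacobi polynomial `P_n^{(α, β)}` as a polynomial in `t = (x - 1) / 2`. -/
noncomputable def shiftedJacobi (α β : ℝ) (n : ℕ) : ℝ[X] :=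
  ∑ k ∈ Finset.range (n + 1), C (jacobiCoeff α β n k) * X ^ k

theorem coeff_shiftedJacobi (α β : ℝ) (n k : ℕ) :
    (shiftedJacobi α β n).coeff k = jacobiCoeff α β n k := by
  simp only [shiftedJacobi, finsetSum_coeff, coeff_C_mul_X_pow, Finset.sum_ite_eq,
    Finset.mem_range, jacobiCoeff]
  grind

theorem jacobi_eq_comp (α β : ℝ) (n : ℕ) :
    jacobi α β n = (shiftedJacobi α β n).comp (C (1 / 2) * (X - 1)) := by
  simp only [jacobi, shiftedJacobi, Polynomial.sum_comp, mul_comp, C_comp, X_pow_comp]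
  refine Finset.sum_congr rfl fun k hk => ?_
  rw [jacobiCoeff, if_pos (Nat.lt_succ_iff.mp (Finset.mem_range.mp hk))]

theorem jacobiCoeff_add (α β : ℝ) (j k : ℕ) : jacobiCoeff α β (k + j) k =
    poch (k + j + α + β + 1) k * poch (α + k + 1) j / ((k.factorial : ℝ) * (j.factorial : ℝ)) := by
  simp [jacobiCoeff]

theorem jacobiCoeff_of_lt (α β : ℝ) {n k : ℕ} (h : n < k) : jacobiCoeff α β n k = 0 := by
  simp [jacobiCoeff, h]

/-- The hypergeometric ratio of consecutive coefficients, cleared of denominators. At `k = n` the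
factor `n - k` matches the cut-off. -/
theorem jacobiCoeff_succ_right (α β : ℝ) (n k : ℕ) :
    (k + 1) * (k + α + 1) * jacobiCoeff α β n (k + 1) =
      (n - k) * (n + k + α + β + 1) * jacobiCoeff α β n k := by
  rcases lt_trichotomy n k with h | rfl | h
  · simp [jacobiCoeff_of_lt α β h, jacobiCoeff_of_lt α β (h.trans (Nat.lt_succ_self k))]
  · simp [jacobiCoeff_of_lt α β (Nat.lt_succ_self n)]
  · obtain ⟨j, rfl⟩ := Nat.exists_eq_add_of_lt h
    have e : k + j + 1 = (k + 1) + j := by ring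
    rw [show jacobiCoeff α β (k + j + 1) k = _ from jacobiCoeff_add α β (j + 1) k, e,
      jacobiCoeff_add, poch_succ, poch_succ_left, Nat.factorial_succ, Nat.factorial_succ]
    push_cast
    have h1 := Nat.cast_ne_zero (R := ℝ).mpr k.factorial_ne_zero
    have h2 := Nat.cast_ne_zero (R := ℝ).mpr j.factorial_ne_zero
    have h3 : (k : ℝ) + 1 ≠ 0 := by positivity
    have h4 : (j : ℝ) + 1 ≠ 0 := by positivity
    field_simp
    ring_nf

theorem jacobiCoeff_zero_right (α β : ℝ) (n : ℕ) :
    jacobiCoeff α β n 0 = poch (α + 1) n / n.factorial := by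
  simp [jacobiCoeff, poch_zero]

theorem jacobiCoeff_self (α β : ℝ) (n : ℕ) :
    jacobiCoeff α β n n = poch (n + α + β + 1) n / n.factorial := by
  simp [jacobiCoeff, poch_zero]

theorem jacobiCoeff_recurrence_zero (α : ℝ) (n : ℕ) :
    (n + 2) * (n + 2 + 2 * α) * jacobiCoeff α α (n + 2) 0 =
      (2 * n + 2 * α + 3) * (n + 2 + α) * jacobiCoeff α α (n + 1) 0 -
        (n + 1 + α) * (n + 2 + α) * jacobiCoeff α α n 0 := by
  simp only [jacobiCoeff_zero_right, poch_succ, Nat.factorial_succ]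
  push_cast
  have h1 := Nat.cast_ne_zero (R := ℝ).mpr n.factorial_ne_zero
  have h2 : (n : ℝ) + 1 ≠ 0 := by positivity
  have h3 : (n : ℝ) + 1 + 1 ≠ 0 := by positivity
  field_simp
  ring

theorem poch_shift (a : ℝ) (k : ℕ) : a * poch (a + 1) k = poch a k * (a + k) := by
  rw [← poch_succ_left, poch_succ]

/-- The coefficient of `t^(k+1)` in the three-term recurrence, where `x = 1 + 2t` produces the two
middle terms. -/
theorem jacobiCoeff_recurrence_succ (α : ℝ) (n k : ℕ) :
    (n + 2) * (n + 2 + 2 * α) * jacobiCoeff α α (n + 2) (k + 1) =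
      (2 * n + 2 * α + 3) * (n + 2 + α) *
        (jacobiCoeff α α (n + 1) (k + 1) + 2 * jacobiCoeff α α (n + 1) k) -
        (n + 1 + α) * (n + 2 + α) * jacobiCoeff α α n (k + 1) := by
  have h1 := Nat.cast_ne_zero (R := ℝ).mpr k.factorial_ne_zero
  have h2 : (k : ℝ) + 1 ≠ 0 := by positivity
  -- The only nontrivial relation needed between Pochhammer symbols. It is kept undivided because
  -- its factors may vanish for general `α`.
  have hs := poch_shift (n + 2 + α + α) k
  rcases lt_trichotomy n k with h | rfl | h
  · rcases (Nat.succ_le_of_lt h).eq_or_lt with h' | h'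
    · obtain rfl : k = n + 1 := h'.symm
      rw [jacobiCoeff_of_lt α α (show n + 1 < n + 1 + 1 by lia),
        jacobiCoeff_of_lt α α (show n < n + 1 + 1 by lia),
        show n + 2 = n + 1 + 1 from rfl,
        jacobiCoeff_self, jacobiCoeff_self, Nat.factorial_succ (n + 1), poch_succ _ (n + 1)]
      push_cast at *
      rw [show (n : ℝ) + 1 + 1 + α + α + 1 = n + 2 + α + α + 1 by ring,
        show (n : ℝ) + 1 + α + α + 1 = n + 2 + α + α by ring]
      generalize poch (n + 2 + α + α + 1) (n + 1) = p at *
      generalize poch (n + 2 + α + α) (n + 1) = q at *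
      field_simp
      linear_combination (2 * n + 2 * α + 4) * (n + 2) * hs
    · rw [jacobiCoeff_of_lt α α (show n + 1 < k + 1 by lia),
        jacobiCoeff_of_lt α α (show n < k + 1 by lia),
        jacobiCoeff_of_lt α α (show n + 1 < k by lia),
        jacobiCoeff_of_lt α α (show n + 2 < k + 1 by lia)]
      ring
  · have a1 := jacobiCoeff_add α α (n + 1) 1
    rw [jacobiCoeff_of_lt α α (Nat.lt_succ_self n), jacobiCoeff_self, jacobiCoeff_add α α 1 n,
      show n + 2 = n + 1 + 1 from rfl, jacobiCoeff_add α α 1 (n + 1)]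
    simp only [poch_succ, poch_zero, Nat.factorial_succ, Nat.factorial_zero]
    push_cast at *
    rw [show (n : ℝ) + 1 + 1 + α + α + 1 = n + 2 + α + α + 1 by ring,
      show (n : ℝ) + 1 + α + α + 1 = n + 2 + α + α by ring]
    generalize poch (n + 2 + α + α + 1) n = p at *
    generalize poch (n + 2 + α + α) n = q at *
    field_simp
    linear_combination (2 * n + 2 * α + 3) * (n + 2 + α) * (n + 2) * hs
  · obtain ⟨j, rfl⟩ := Nat.exists_eq_add_of_lt h
    have h3 := Nat.cast_ne_zero (R := ℝ).mpr j.factorial_ne_zero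
    have h4 : (j : ℝ) + 1 ≠ 0 := by positivity
    have h5 : (j : ℝ) + 1 + 1 ≠ 0 := by positivity
    rw [show k + j + 1 + 2 = k + 1 + (j + 2) by ring, jacobiCoeff_add,
      show k + j + 1 + 1 = k + 1 + (j + 1) by ring, jacobiCoeff_add,
      show k + 1 + (j + 1) = k + (j + 2) by ring, jacobiCoeff_add,
      show k + j + 1 = k + 1 + j by ring, jacobiCoeff_add]
    have hs' := poch_shift (k + j + 3 + α + α) k
    have e1 := poch_succ_left (k + j + 2 + α + α) k
    have e2 := poch_succ_left (α + k + 1) (j + 1)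
    push_cast at *
    rw [show (k : ℝ) + 1 + (j + 2) + α + α + 1 = k + j + 3 + α + α + 1 by ring,
      show (k : ℝ) + 1 + (j + 1) + α + α + 1 = k + j + 3 + α + α by ring,
      show (k : ℝ) + (j + 2) + α + α + 1 = k + j + 3 + α + α by ring,
      show (k : ℝ) + 1 + j + α + α + 1 = k + j + 2 + α + α by ring,
      show α + ((k : ℝ) + 1) + 1 = α + k + 1 + 1 by ring, e1,
      show j + 2 = j + 1 + 1 from rfl, e2,
      show (k : ℝ) + j + 2 + α + α + 1 = k + j + 3 + α + α by ring]
    simp only [poch_succ, Nat.factorial_succ]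
    push_cast
    generalize poch (k + j + 3 + α + α + 1) k = p at *
    generalize poch (k + j + 3 + α + α) k = q at *
    generalize poch (α + k + 1 + 1) j = r at *
    field_simp
    linear_combination (k + j + 3) * (α + k + 1 + 1 + j) * (α + k + 1 + 1 + j + 1) *
      (k + j + 3 + α + α + 1 + k) * r * hs'

/-! ### Three-term recurrence and differential equation -/

theorem jacobi_zero (α β : ℝ) : jacobi α β 0 = 1 := by
  simp [jacobi, poch_zero]

theorem jacobi_one (α : ℝ) : jacobi α α 1 = C (α + 1) * X := by
  simp only [jacobi, Finset.sum_range_succ, Finset.sum_range_zero, poch_succ, poch_zero]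
  refine Polynomial.funext fun x => ?_
  simp [poch_zero]
  ring

theorem jacobi_recurrence (α : ℝ) (n : ℕ) :
    C ((n + 2) * (n + 2 + 2 * α)) * jacobi α α (n + 2) =
      C ((2 * n + 2 * α + 3) * (n + 2 + α)) * X * jacobi α α (n + 1) -
        C ((n + 1 + α) * (n + 2 + α)) * jacobi α α n := by
  have h : C ((n + 2) * (n + 2 + 2 * α)) * shiftedJacobi α α (n + 2) =
      C ((2 * n + 2 * α + 3) * (n + 2 + α)) * (shiftedJacobi α α (n + 1) +
        C 2 * (X * shiftedJacobi α α (n + 1))) -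
        C ((n + 1 + α) * (n + 2 + α)) * shiftedJacobi α α n := by
    ext k
    cases k with
    | zero =>
      simp only [coeff_C_mul, coeff_sub, coeff_add, coeff_shiftedJacobi, coeff_X_mul_zero]
      rw [jacobiCoeff_recurrence_zero]
      ring
    | succ k =>
      simp only [coeff_C_mul, coeff_sub, coeff_add, coeff_shiftedJacobi, coeff_X_mul]
      exact jacobiCoeff_recurrence_succ α n k
  have h' := congrArg (fun p : ℝ[X] => p.comp (C (1 / 2) * (X - 1))) h
  simp only [sub_comp, add_comp, mul_comp, C_comp, X_comp, ← jacobi_eq_comp] at h'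
  rw [h']
  have e : (C 2 : ℝ[X]) * C (1 / 2) = 1 := by rw [← C_mul]; norm_num
  linear_combination C ((2 * n + 2 * α + 3) * (n + 2 + α)) * (X - 1) * jacobi α α (n + 1) * e

theorem jacobi_differentialEquation (α : ℝ) (n : ℕ) :
    (1 - X ^ 2) * derivative (derivative (jacobi α α n)) -
      C (2 * (α + 1)) * X * derivative (jacobi α α n) +
      C (n * (n + 2 * α + 1)) * jacobi α α n = 0 := by
  -- The hypergeometric equation in `t`. Written with the Euler operator `t d/dt`, it reads on
  -- coefficients as the ratio `jacobiCoeff_succ_right`.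
  have h : X * derivative (X * derivative (shiftedJacobi α α n)) +
        X * derivative (derivative (shiftedJacobi α α n)) +
        C (2 * α + 1) * (X * derivative (shiftedJacobi α α n)) +
        C (α + 1) * derivative (shiftedJacobi α α n) -
      C (n * (n + 2 * α + 1)) * shiftedJacobi α α n = 0 := by
    ext k
    cases k with
    | zero =>
      have := jacobiCoeff_succ_right α α n 0
      simp [coeff_derivative, coeff_shiftedJacobi, -map_mul, -map_add] at this ⊢
      linear_combination this
    | succ k =>
      have := jacobiCoeff_succ_right α α n (k + 1)
      simp only [coeff_C_mul, coeff_sub, coeff_add, coeff_shiftedJacobi, coeff_X_mul,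
        coeff_derivative, coeff_zero] at this ⊢
      push_cast at this ⊢
      linear_combination this
  have h' := congrArg (fun p : ℝ[X] => p.comp (C (1 / 2) * (X - 1))) h
  rw [jacobi_eq_comp]
  simp only [derivative_mul, derivative_X, sub_comp, add_comp, mul_comp, C_comp, X_comp,
    derivative_comp, derivative_C, derivative_sub, derivative_one, one_comp, zero_comp, zero_mul, zero_add,
    sub_zero, mul_one] at h' ⊢
  have e : (C (1 / 2) : ℝ[X]) * 2 = 1 := by
    rw [show (2 : ℝ[X]) = C 2 from rfl, ← C_mul]; norm_num
  simp only [C_add, C_mul, C_1, show (C 2 : ℝ[X]) = 2 from rfl] at h' ⊢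
  linear_combination -h' - ((X - 1) * C (1 / 2) *
    (derivative (derivative (shiftedJacobi α α n))).comp (C (1 / 2) * (X - 1)) +
    (C α + 1) * (derivative (shiftedJacobi α α n)).comp (C (1 / 2) * (X - 1))) * e

/-! ### Orthogonality and norms -/

theorem gegenbauerIntegral_C_mul {α : ℝ} (hα : -1 < α) (c : ℝ) (f : ℝ[X]) :
    gegenbauerIntegral hα (C c * f) = c * gegenbauerIntegral hα f := by
  rw [← smul_eq_C_mul, map_smul, smul_eq_mul]

/-- Integrating by parts the Wronskian of the two solutions leaves the difference of eigenvalues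
times the inner product. The difference is `(k - m)(k + m + 2α + 1)`, nonzero since `k + m ≥ 1` and
`α > -1`. -/
theorem gegenbauerIntegral_jacobi_mul_jacobi {α : ℝ} (hα : -1 < α) {m k : ℕ} (h : m ≠ k) :
    gegenbauerIntegral hα (jacobi α α m * jacobi α α k) = 0 := by
  have h1 := jacobi_differentialEquation α m
  have h2 := jacobi_differentialEquation α k
  have h3 := gegenbauerIntegral_byParts hα (derivative (jacobi α α m) * jacobi α α k -
    jacobi α α m * derivative (jacobi α α k))
  have e : (1 - X ^ 2) * derivative (derivative (jacobi α α m) * jacobi α α k -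
      jacobi α α m * derivative (jacobi α α k)) - C (2 * (α + 1)) * X *
        (derivative (jacobi α α m) * jacobi α α k - jacobi α α m * derivative (jacobi α α k)) =
      C (k * (k + 2 * α + 1) - m * (m + 2 * α + 1)) * (jacobi α α m * jacobi α α k) := by
    rw [C_sub]
    simp only [derivative_sub, derivative_mul]
    linear_combination jacobi α α k * h1 - jacobi α α m * h2
  rw [e, gegenbauerIntegral_C_mul] at h3
  refine (mul_eq_zero.mp h3).resolve_left fun h0 => ?_
  have h4 : ((k : ℝ) - m) * (k + m + 2 * α + 1) = 0 := by linear_combination h0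
  have h5 : (1 : ℝ) ≤ k + m := by exact_mod_cast (by lia : 1 ≤ k + m)
  rcases mul_eq_zero.mp h4 with h6 | h6
  · exact h (by exact_mod_cast (sub_eq_zero.mp h6).symm)
  · linarith

theorem gegenbauerIntegral_jacobi_recurrence {α : ℝ} (hα : -1 < α) (n : ℕ) (f : ℝ[X]) :
    (n + 2) * (n + 2 + 2 * α) * gegenbauerIntegral hα (jacobi α α (n + 2) * f) =
      (2 * n + 2 * α + 3) * (n + 2 + α) * gegenbauerIntegral hα (X * jacobi α α (n + 1) * f) -
        (n + 1 + α) * (n + 2 + α) * gegenbauerIntegral hα (jacobi α α n * f) := by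
  rw [← gegenbauerIntegral_C_mul, ← gegenbauerIntegral_C_mul, ← gegenbauerIntegral_C_mul,
    ← map_sub]
  congr 1
  linear_combination f * jacobi_recurrence α n

theorem gegenbauerIntegral_X_sq {α : ℝ} (hα : -1 < α) :
    (2 * α + 3) * gegenbauerIntegral hα (X * X) = gegenbauerIntegral hα 1 := by
  have h := gegenbauerIntegral_byParts hα X
  have e : (1 - X ^ 2) * derivative X - C (2 * (α + 1)) * X * X =
      1 - C (2 * α + 3) * (X * X) := by
    simp only [derivative_X, C_add, C_mul, C_1, show (C 2 : ℝ[X]) = 2 from rfl,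
      show (C 3 : ℝ[X]) = 3 from rfl]
    ring
  rw [e, map_sub, gegenbauerIntegral_C_mul] at h
  linarith

/-- Pairing two consecutive recurrences with `P_{n+2}` and `P_{n+1}` and eliminating the common
integral of `x P_{n+1} P_{n+2}` relates successive norms. Degree `0` is excluded: its factor `(2α +
1) Γ(2α + 1)` degenerates at `α = -1/2`. -/
theorem gegenbauerIntegral_jacobi_sq_succ {α : ℝ} (hα : -1 < α) (n : ℕ) :
    (2 * n + 2 * α + 3) * Real.Gamma (n + 2 * α + 2) * (n + 1).factorial *
      gegenbauerIntegral hα (jacobi α α (n + 1) * jacobi α α (n + 1)) =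
      2 ^ (2 * α + 1) * Real.Gamma (n + α + 2) ^ 2 := by
  induction n with
  | zero =>
    have h0 : 0 < Real.Gamma (2 * α + 2) := Real.Gamma_pos_of_pos (by linarith)
    have h1 := gegenbauerIntegral_X_sq hα
    rw [gegenbauerIntegral_one, eq_div_iff h0.ne'] at h1
    have h2 := Real.Gamma_add_one (s := α + 1) (by linarith)
    rw [show jacobi α α (0 + 1) * jacobi α α (0 + 1) =
      C ((α + 1) * (α + 1)) * (X * X) by rw [zero_add, jacobi_one, C_mul]; ring,
      gegenbauerIntegral_C_mul]
    rw [show α + 1 + 1 = α + 2 by ring] at h2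
    simp only [Nat.cast_zero, mul_zero, zero_add, Nat.factorial_one, Nat.cast_one, h2]
    linear_combination (α + 1) ^ 2 * h1
  | succ n ih =>
    have hn : (0 : ℝ) ≤ n := n.cast_nonneg
    have r1 := gegenbauerIntegral_jacobi_recurrence hα n (jacobi α α (n + 2))
    have r2 := gegenbauerIntegral_jacobi_recurrence hα (n + 1) (jacobi α α (n + 1))
    rw [gegenbauerIntegral_jacobi_mul_jacobi hα (show n ≠ n + 2 by lia)] at r1
    rw [gegenbauerIntegral_jacobi_mul_jacobi hα (show n + 1 + 2 ≠ n + 1 by lia),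
      show X * jacobi α α (n + 1 + 1) * jacobi α α (n + 1) =
        X * jacobi α α (n + 1) * jacobi α α (n + 2) by ring] at r2
    have h1 := Real.Gamma_add_one (s := n + 2 * α + 2) (by linarith)
    have h2 := Real.Gamma_add_one (s := n + α + 2) (by linarith)
    rw [Nat.factorial_succ]
    push_cast at *
    rw [show (n : ℝ) + 1 + 2 * α + 2 = n + 2 * α + 2 + 1 by ring,
      show (n : ℝ) + 1 + α + 2 = n + α + 2 + 1 by ring, h1, h2]
    have r3 : (2 * n + 2 * α + 5) *
        gegenbauerIntegral hα (X * jacobi α α (n + 1) * jacobi α α (n + 2)) =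
        (n + α + 2) * gegenbauerIntegral hα (jacobi α α (n + 1) * jacobi α α (n + 1)) := by
      have h3 : (n : ℝ) + 3 + α ≠ 0 := by linarith
      apply mul_left_cancel₀ h3
      linear_combination -r2
    rw [show n + 1 + 1 = n + 2 from rfl]
    linear_combination (n + α + 2) ^ 2 * ih + (2 * n + 2 * α + 3) * (n + 2 + α) *
      Real.Gamma (n + 2 * α + 2) * (n + 1).factorial * r3 +
      (2 * n + 2 * α + 5) * Real.Gamma (n + 2 * α + 2) * (n + 1).factorial * r1

/-! ### The quotient of an odd polynomial by `x` -/

/-- The polynomial `P_{2n+1}^{(α, α)}(x) / x`. -/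
noncomputable def oddJacobiDivX (α : ℝ) (n : ℕ) : ℝ[X] := divX (jacobi α α (2 * n + 1))

/-- At `x = 0` the recurrence loses its middle term and links odd degrees only to each other. -/
theorem jacobi_odd_coeff_zero {α : ℝ} (hα : -1 < α) (n : ℕ) :
    (jacobi α α (2 * n + 1)).coeff 0 = 0 := by
  induction n with
  | zero => simp [jacobi_one]
  | succ n ih =>
    have h := congrArg (fun p : ℝ[X] => p.coeff 0) (jacobi_recurrence α (2 * n + 1))
    simp only [coeff_C_mul, coeff_sub, ih, mul_assoc, coeff_X_mul_zero, mul_zero, sub_zero] at h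
    have hn : (0 : ℝ) ≤ n := n.cast_nonneg
    push_cast at h
    have h1 : (2 * n + 1 + 2 : ℝ) ≠ 0 := by positivity
    have h2 : (2 * n + 1 + 2 + 2 * α : ℝ) ≠ 0 := by linarith
    exact (mul_eq_zero.mp ((mul_eq_zero.mp h).resolve_left h1)).resolve_left h2

theorem X_mul_oddJacobiDivX {α : ℝ} (hα : -1 < α) (n : ℕ) :
    X * oddJacobiDivX α n = jacobi α α (2 * n + 1) := by
  have h := X_mul_divX_add (jacobi α α (2 * n + 1))
  rwa [jacobi_odd_coeff_zero hα, C_0, add_zero] at h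

theorem oddJacobiDivX_zero (α : ℝ) : oddJacobiDivX α 0 = C (α + 1) := by
  rw [oddJacobiDivX, mul_zero, zero_add, jacobi_one, divX_C_mul, ← pow_one X, divX_X_pow,
    if_neg one_ne_zero, Nat.sub_self, pow_zero, mul_one]

theorem oddJacobiDivX_succ {α : ℝ} (hα : -1 < α) (n : ℕ) :
    C ((2 * n + 3) * (2 * n + 3 + 2 * α)) * oddJacobiDivX α (n + 1) =
      C ((4 * n + 2 * α + 5) * (2 * n + 3 + α)) * jacobi α α (2 * n + 2) -
        C ((2 * n + 2 + α) * (2 * n + 3 + α)) * oddJacobiDivX α n := by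
  have h := jacobi_recurrence α (2 * n + 1)
  rw [← X_mul_oddJacobiDivX hα, show 2 * n + 1 + 2 = 2 * (n + 1) + 1 by ring,
    ← X_mul_oddJacobiDivX hα] at h
  push_cast at h
  rw [show (2 * n + 1 + 2 : ℝ) = 2 * n + 3 by ring, show (2 * n + 1 + 1 : ℝ) = 2 * n + 2 by ring,
    show (2 * (2 * n + 1) + 2 * α + 3 : ℝ) = 4 * n + 2 * α + 5 by ring] at h
  apply mul_left_cancel₀ (X_ne_zero (R := ℝ))
  linear_combination h

theorem gegenbauerIntegral_oddJacobiDivX_succ {α : ℝ} (hα : -1 < α) (n : ℕ) (f : ℝ[X]) :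
    (2 * n + 3) * (2 * n + 3 + 2 * α) * gegenbauerIntegral hα (oddJacobiDivX α (n + 1) * f) =
      (4 * n + 2 * α + 5) * (2 * n + 3 + α) *
          gegenbauerIntegral hα (jacobi α α (2 * n + 2) * f) -
        (2 * n + 2 + α) * (2 * n + 3 + α) * gegenbauerIntegral hα (oddJacobiDivX α n * f) := by
  rw [← gegenbauerIntegral_C_mul, ← gegenbauerIntegral_C_mul, ← gegenbauerIntegral_C_mul,
    ← map_sub]
  congr 1
  linear_combination f * oddJacobiDivX_succ hα n

/-- By the divided recurrence, the quotient is a combination of `P_0, P_2, …, P_{2n}`. -/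
theorem gegenbauerIntegral_oddJacobiDivX_mul_jacobi {α : ℝ} (hα : -1 < α) {n m : ℕ}
    (h : 2 * n < m) : gegenbauerIntegral hα (oddJacobiDivX α n * jacobi α α m) = 0 := by
  induction n with
  | zero =>
    have h0 := gegenbauerIntegral_jacobi_mul_jacobi hα (show 0 ≠ m by lia)
    rw [jacobi_zero, one_mul] at h0
    rw [oddJacobiDivX_zero, gegenbauerIntegral_C_mul, h0, mul_zero]
  | succ n ih =>
    have hn : (0 : ℝ) ≤ n := n.cast_nonneg
    have r := gegenbauerIntegral_oddJacobiDivX_succ hα n (jacobi α α m)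
    rw [ih (by lia), gegenbauerIntegral_jacobi_mul_jacobi hα (show 2 * n + 2 ≠ m by lia), mul_zero,
      mul_zero, sub_zero] at r
    exact (mul_eq_zero.mp r).resolve_left
      (mul_ne_zero (by positivity) (by linarith))

theorem gegenbauerIntegral_oddJacobiDivX_sq {α : ℝ} (hα : -1 < α) (n : ℕ) :
    Real.Gamma (2 * n + 2 * α + 2) * (2 * n + 1).factorial *
      gegenbauerIntegral hα (oddJacobiDivX α n * oddJacobiDivX α n) =
      2 ^ (2 * α + 1) * Real.Gamma (2 * n + α + 2) ^ 2 := by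
  induction n with
  | zero =>
    have h0 : 0 < Real.Gamma (2 * α + 2) := Real.Gamma_pos_of_pos (by linarith)
    have h2 := Real.Gamma_add_one (s := α + 1) (by linarith)
    rw [show α + 1 + 1 = α + 2 by ring] at h2
    rw [oddJacobiDivX_zero, gegenbauerIntegral_C_mul, ← mul_one (C (α + 1)),
      gegenbauerIntegral_C_mul, gegenbauerIntegral_one]
    simp only [Nat.cast_zero, mul_zero, zero_add, Nat.factorial_one, Nat.cast_one, h2]
    rw [eq_comm]
    generalize Real.Gamma (2 * α + 2) = G at *
    field_simp
  | succ n ih =>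
    have hn : (0 : ℝ) ≤ n := n.cast_nonneg
    have o1 := gegenbauerIntegral_oddJacobiDivX_mul_jacobi hα (show 2 * n < 2 * n + 2 by lia)
    have r1 := gegenbauerIntegral_oddJacobiDivX_succ hα n (oddJacobiDivX α (n + 1))
    have r2 := gegenbauerIntegral_oddJacobiDivX_succ hα n (jacobi α α (2 * n + 2))
    have r3 := gegenbauerIntegral_oddJacobiDivX_succ hα n (oddJacobiDivX α n)
    have hh := gegenbauerIntegral_jacobi_sq_succ hα (2 * n + 1)
    rw [mul_comm (jacobi α α _)] at r1
    rw [o1, mul_comm (jacobi α α _) (jacobi α α _)] at r2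
    rw [mul_comm (jacobi α α _), o1, mul_comm (oddJacobiDivX α (n + 1))] at r3
    have g1 := Real.Gamma_add_one (s := 2 * n + 2 * α + 2) (by linarith)
    have g2 := Real.Gamma_add_one (s := 2 * n + 2 * α + 3) (by linarith)
    have g3 := Real.Gamma_add_one (s := 2 * n + α + 2) (by linarith)
    have g4 := Real.Gamma_add_one (s := 2 * n + α + 3) (by linarith)
    rw [show (2 * n + 2 * α + 2 + 1 : ℝ) = 2 * n + 2 * α + 3 by ring] at g1
    rw [show (2 * n + 2 * α + 3 + 1 : ℝ) = 2 * n + 2 * α + 4 by ring, g1] at g2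
    rw [show (2 * n + α + 2 + 1 : ℝ) = 2 * n + α + 3 by ring] at g3
    rw [show (2 * n + α + 3 + 1 : ℝ) = 2 * n + α + 4 by ring, g3] at g4
    rw [Nat.factorial_succ, show 2 * n + 1 + 1 = 2 * n + 2 from rfl] at hh
    rw [show 2 * (n + 1) + 1 = 2 * n + 1 + 1 + 1 by ring, Nat.factorial_succ, Nat.factorial_succ]
    push_cast at *
    rw [show (2 * n + 1 + 2 * α + 2 : ℝ) = 2 * n + 2 * α + 3 by ring,
      show (2 * n + 1 + α + 2 : ℝ) = 2 * n + α + 3 by ring, g1, g3] at hh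
    rw [show (2 * (n + 1) + 2 * α + 2 : ℝ) = 2 * n + 2 * α + 4 by ring,
      show (2 * (n + 1) + α + 2 : ℝ) = 2 * n + α + 4 by ring, g2, g4]
    -- Pythagoras needs `A²` with `A = (2n+3)(2n+3+2α)`; the Gamma value and the factorial supply
    -- only one factor `A`.
    apply mul_left_cancel₀ (mul_ne_zero (show (2 * n + 3 : ℝ) ≠ 0 by positivity)
      (show (2 * n + 3 + 2 * α : ℝ) ≠ 0 by linarith))
    generalize Real.Gamma (2 * n + 2 * α + 2) = G at *
    generalize Real.Gamma (2 * n + α + 2) = g at *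
    generalize ((2 * n + 1).factorial : ℝ) = F at *
    -- The bracket `A r1 + B r2 - C r3` is the Pythagorean relation. With `a = 2n + 2` and `b = a +
    -- 2α`, the rest is `(a + b + 1) + a b = (a + 1)(b + 1)`.
    linear_combination (2 * n + 2 * α + 2) * G * (2 * n + 2) * F *
        ((2 * n + 3) * (2 * n + 3 + 2 * α) * r1 + (4 * n + 2 * α + 5) * (2 * n + 3 + α) * r2 -
          (2 * n + 2 + α) * (2 * n + 3 + α) * r3) +
      (4 * n + 2 * α + 5) * (2 * n + 3 + α) ^ 2 * hh +
      ((2 * n + 2 + α) * (2 * n + 3 + α)) ^ 2 * (2 * n + 2 * α + 2) * (2 * n + 2) * ih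

/-! ### The general formula and its rescaling -/

theorem intervalIntegrable_oddJacobi_div_sq {α : ℝ} (hα : -1 < α) (n : ℕ) :
    IntervalIntegrable
        (fun x : ℝ => ((jacobi α α (2 * n + 1)).eval x / x) ^ 2 * (1 - x ^ 2) ^ α)
        volume (-1) 1 ∧
      ∫ x in (-1 : ℝ)..1, ((jacobi α α (2 * n + 1)).eval x / x) ^ 2 * (1 - x ^ 2) ^ α =
        (2 : ℝ) ^ (2 * α + 1) * Real.Gamma (2 * n + α + 2) ^ 2 /
          (Real.Gamma (2 * n + 2 * α + 2) * ((2 * n + 1).factorial : ℝ)) := by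
  have hn : (0 : ℝ) ≤ n := n.cast_nonneg
  have hG : 0 < Real.Gamma (2 * n + 2 * α + 2) := Real.Gamma_pos_of_pos (by linarith)
  -- At `x = 0` division by zero returns `0` instead of the value of the quotient polynomial; a
  -- single point is negligible.
  have hae : (fun x : ℝ => (oddJacobiDivX α n * oddJacobiDivX α n).eval x * (1 - x ^ 2) ^ α)
      =ᵐ[volume] fun x : ℝ => ((jacobi α α (2 * n + 1)).eval x / x) ^ 2 * (1 - x ^ 2) ^ α := by
    filter_upwards [compl_mem_ae_iff.mpr (measure_singleton (0 : ℝ))] with x hx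
    have hx0 : x ≠ 0 := hx
    rw [← X_mul_oddJacobiDivX hα, eval_mul, eval_mul, eval_X, mul_div_cancel_left₀ _ hx0, pow_two (eval x _)]
  refine ⟨(intervalIntegrable_eval_mul_gegenbauerWeight hα _).congr_ae
    (ae_restrict_of_ae hae), ?_⟩
  rw [← intervalIntegral.integral_congr_ae (hae.mono fun x hx _ => hx),
    eq_div_iff (by positivity), ← gegenbauerIntegral_oddJacobiDivX_sq hα n, mul_comm]
  rfl

theorem intervalIntegrable_const_mul_oddJacobi_div_sq {α : ℝ} (hα : -1 < α) (c : ℝ) (n : ℕ) :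
    IntervalIntegrable
        (fun x : ℝ => ((C c * jacobi α α (2 * n + 1)).eval x / x) ^ 2 * (1 - x ^ 2) ^ α)
        volume (-1) 1 ∧
      ∫ x in (-1 : ℝ)..1, ((C c * jacobi α α (2 * n + 1)).eval x / x) ^ 2 * (1 - x ^ 2) ^ α =
        c ^ 2 * ((2 : ℝ) ^ (2 * α + 1) * Real.Gamma (2 * n + α + 2) ^ 2 /
          (Real.Gamma (2 * n + 2 * α + 2) * ((2 * n + 1).factorial : ℝ))) := by
  have h := intervalIntegrable_oddJacobi_div_sq hα n
  have e (x : ℝ) : ((C c * jacobi α α (2 * n + 1)).eval x / x) ^ 2 * (1 - x ^ 2) ^ α =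
      c ^ 2 * (((jacobi α α (2 * n + 1)).eval x / x) ^ 2 * (1 - x ^ 2) ^ α) := by
    rw [eval_mul, eval_C]
    ring
  simp only [e]
  exact ⟨h.1.const_mul _, by rw [intervalIntegral.integral_const_mul, h.2]⟩

/-! ### Chebyshev polynomials and the special cases -/

theorem chebyshev_T_eq_jacobi (m : ℕ) : Polynomial.Chebyshev.T ℝ m =
    C ((m.factorial : ℝ) / poch (1 / 2) m) * jacobi (-1 / 2) (-1 / 2) m := by
  induction m using Nat.twoStepInduction with
  | zero => simp [poch_zero, jacobi_zero]
  | one =>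
    rw [jacobi_one, ← mul_assoc, ← C_mul, poch_succ, poch_zero]
    norm_num
  | more n ih1 ih2 =>
    have h := jacobi_recurrence (-1 / 2) n
    have hp := (poch_pos (show (0 : ℝ) < 1 / 2 by norm_num) n).ne'
    have h1 : (1 / 2 + n : ℝ) ≠ 0 := by positivity
    have h2 : (1 / 2 + (n + 1) : ℝ) ≠ 0 := by positivity
    -- With this `κ`, the normalizing factors for degrees `n + 2`, `n + 1` (doubled) and `n` are `κ`
    -- times the three recurrence coefficients, so the recurrence becomes `T_{n+2} = 2 x T_{n+1} -
    -- T_n`.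
    set κ : ℝ := n.factorial / poch (1 / 2) (n + 2) with hκ
    have e1 : ((n + 2).factorial : ℝ) / poch (1 / 2) (n + 2) =
        κ * ((n + 2) * (n + 2 + 2 * (-1 / 2))) := by
      rw [hκ, Nat.factorial_succ, Nat.factorial_succ]
      push_cast
      ring
    have e2 : 2 * (((n + 1).factorial : ℝ) / poch (1 / 2) (n + 1)) =
        κ * ((2 * n + 2 * (-1 / 2) + 3) * (n + 2 + -1 / 2)) := by
      rw [hκ, Nat.factorial_succ, poch_succ _ (n + 1), poch_succ]
      push_cast
      field_simp
      ring
    have e3 : (n.factorial : ℝ) / poch (1 / 2) n =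
        κ * ((n + 1 + -1 / 2) * (n + 2 + -1 / 2)) := by
      rw [hκ, poch_succ _ (n + 1), poch_succ]
      push_cast
      field_simp
      ring
    have h3 := Polynomial.Chebyshev.T_add_two ℝ (n : ℤ)
    push_cast at ih2 ⊢
    have e4 := congrArg C e2
    rw [C_mul, C_mul (a := κ)] at e4
    rw [h3, ih1, ih2, e1, e3, show (2 : ℝ[X]) = C 2 from rfl, C_mul (a := κ), C_mul (a := κ)]
    linear_combination X * jacobi (-1 / 2) (-1 / 2) (n + 1) * e4 - C κ * h

theorem chebyshev_U_eq_jacobi (m : ℕ) : Polynomial.Chebyshev.U ℝ m =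
    C (((m + 1).factorial : ℝ) / poch (3 / 2) m) * jacobi (1 / 2) (1 / 2) m := by
  induction m using Nat.twoStepInduction with
  | zero => simp [poch_zero, jacobi_zero]
  | one =>
    rw [jacobi_one, ← mul_assoc, ← C_mul, poch_succ, poch_zero]
    norm_num [Nat.factorial]
    rfl
  | more n ih1 ih2 =>
    have h := jacobi_recurrence (1 / 2) n
    have hp := (poch_pos (show (0 : ℝ) < 3 / 2 by norm_num) n).ne'
    have h1 : (3 / 2 + n : ℝ) ≠ 0 := by positivity
    have h2 : (3 / 2 + (n + 1) : ℝ) ≠ 0 := by positivity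
    set κ : ℝ := (n + 1).factorial / poch (3 / 2) (n + 2) with hκ
    have e1 : ((n + 2 + 1).factorial : ℝ) / poch (3 / 2) (n + 2) =
        κ * ((n + 2) * (n + 2 + 2 * (1 / 2))) := by
      rw [hκ, Nat.factorial_succ (n + 2), Nat.factorial_succ (n + 1)]
      push_cast
      ring
    have e2 : 2 * (((n + 1 + 1).factorial : ℝ) / poch (3 / 2) (n + 1)) =
        κ * ((2 * n + 2 * (1 / 2) + 3) * (n + 2 + 1 / 2)) := by
      rw [hκ, Nat.factorial_succ (n + 1), poch_succ _ (n + 1), poch_succ]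
      push_cast
      field_simp
      ring
    have e3 : ((n + 1).factorial : ℝ) / poch (3 / 2) n =
        κ * ((n + 1 + 1 / 2) * (n + 2 + 1 / 2)) := by
      rw [hκ, poch_succ _ (n + 1), poch_succ]
      push_cast
      field_simp
      ring
    have h3 := Polynomial.Chebyshev.U_add_two ℝ (n : ℤ)
    push_cast at ih2 ⊢
    have e4 := congrArg C e2
    rw [C_mul, C_mul (a := κ)] at e4
    rw [h3, ih1, ih2, e1, e3, show (2 : ℝ[X]) = C 2 from rfl, C_mul (a := κ), C_mul (a := κ)]
    linear_combination X * jacobi (1 / 2) (1 / 2) (n + 1) * e4 - C κ * h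

theorem mainTheorem2 :
    -- the general formula for Gegenbauer (symmetric Jacobi) polynomials
    (∀ α : ℝ, -1 < α → ∀ n : ℕ,
      IntervalIntegrable
        (fun x : ℝ => ((jacobi α α (2 * n + 1)).eval x / x) ^ 2 * (1 - x ^ 2) ^ α)
        MeasureTheory.volume (-1) 1 ∧
      ∫ x in (-1 : ℝ)..1, ((jacobi α α (2 * n + 1)).eval x / x) ^ 2 * (1 - x ^ 2) ^ α =
        (2 : ℝ) ^ (2 * α + 1) * Real.Gamma (2 * n + α + 2) ^ 2 /
          (Real.Gamma (2 * n + 2 * α + 2) * ((2 * n + 1).factorial : ℝ))) ∧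
    -- Legendre polynomials
    (∀ n : ℕ,
      IntervalIntegrable (fun x : ℝ => ((legendre (2 * n + 1)).eval x / x) ^ 2)
        MeasureTheory.volume (-1) 1 ∧
      ∫ x in (-1 : ℝ)..1, ((legendre (2 * n + 1)).eval x / x) ^ 2 = 2) ∧
    -- Chebyshev polynomials of the first kind
    (∀ m : ℕ, Polynomial.Chebyshev.T ℝ m =
      Polynomial.C ((m.factorial : ℝ) / poch (1 / 2) m) * jacobi (-1 / 2) (-1 / 2) m) ∧
    (∀ n : ℕ,
      IntervalIntegrable
        (fun x : ℝ => ((Polynomial.Chebyshev.T ℝ ((2 * n + 1 : ℕ) : ℤ)).eval x / x) ^ 2 *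
          (1 - x ^ 2) ^ (-1 / 2 : ℝ))
        MeasureTheory.volume (-1) 1 ∧
      ∫ x in (-1 : ℝ)..1, ((Polynomial.Chebyshev.T ℝ ((2 * n + 1 : ℕ) : ℤ)).eval x / x) ^ 2 *
          (1 - x ^ 2) ^ (-1 / 2 : ℝ) = (2 * n + 1) * Real.pi) ∧
    -- Chebyshev polynomials of the second kind
    (∀ m : ℕ, Polynomial.Chebyshev.U ℝ m =
      Polynomial.C (((m + 1).factorial : ℝ) / poch (3 / 2) m) * jacobi (1 / 2) (1 / 2) m) ∧
    (∀ n : ℕ,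
      IntervalIntegrable
        (fun x : ℝ => ((Polynomial.Chebyshev.U ℝ ((2 * n + 1 : ℕ) : ℤ)).eval x / x) ^ 2 *
          (1 - x ^ 2) ^ (1 / 2 : ℝ))
        MeasureTheory.volume (-1) 1 ∧
      ∫ x in (-1 : ℝ)..1, ((Polynomial.Chebyshev.U ℝ ((2 * n + 1 : ℕ) : ℤ)).eval x / x) ^ 2 *
          (1 - x ^ 2) ^ (1 / 2 : ℝ) = (2 * n + 2) * Real.pi) := by
  refine ⟨fun α hα n => intervalIntegrable_oddJacobi_div_sq hα n, fun n => ?_,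
    chebyshev_T_eq_jacobi, fun n => ?_, chebyshev_U_eq_jacobi, fun n => ?_⟩
  · have h := intervalIntegrable_oddJacobi_div_sq (α := 0) (by norm_num) n
    simp only [Real.rpow_zero, mul_one, mul_zero, add_zero, zero_add, Real.rpow_one] at h
    refine ⟨h.1, h.2.trans ?_⟩
    have hG := Real.Gamma_nat_eq_factorial (2 * n + 1)
    push_cast at hG
    rw [show (2 * n + 2 : ℝ) = 2 * n + 1 + 1 by ring, hG]
    have hF := Nat.cast_ne_zero (R := ℝ).mpr (2 * n + 1).factorial_ne_zero
    field_simp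
  · rw [chebyshev_T_eq_jacobi]
    have h := intervalIntegrable_const_mul_oddJacobi_div_sq (α := -1 / 2) (by norm_num)
      ((2 * n + 1).factorial / poch (1 / 2) (2 * n + 1)) n
    refine ⟨h.1, h.2.trans ?_⟩
    have hp := (poch_pos (show (0 : ℝ) < 1 / 2 by norm_num) (2 * n + 1)).ne'
    -- `Γ(2n + 3/2) = (1/2)_{2n+1} √π`, so the Pochhammer symbol cancels the one in the
    -- normalization of `T`.
    have hg := Gamma_add_natCast_eq_poch (show (0 : ℝ) < 1 / 2 by norm_num) (2 * n + 1)
    have hG := Real.Gamma_nat_eq_factorial (2 * n)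
    push_cast at hg hG
    rw [show (2 * n + -1 / 2 + 2 : ℝ) = 1 / 2 + (2 * n + 1) by ring, hg,
      show (2 * n + 2 * (-1 / 2) + 2 : ℝ) = 2 * n + 1 by ring, hG, Real.Gamma_one_half_eq,
      mul_pow, Real.sq_sqrt Real.pi_pos.le, Nat.factorial_succ]
    have hF := Nat.cast_ne_zero (R := ℝ).mpr (2 * n).factorial_ne_zero
    have hn : (2 * n + 1 : ℝ) ≠ 0 := by positivity
    norm_num
    field_simp
  · rw [chebyshev_U_eq_jacobi]
    have h := intervalIntegrable_const_mul_oddJacobi_div_sq (α := 1 / 2) (by norm_num)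
      ((2 * n + 1 + 1).factorial / poch (3 / 2) (2 * n + 1)) n
    refine ⟨h.1, h.2.trans ?_⟩
    have hp := (poch_pos (show (0 : ℝ) < 3 / 2 by norm_num) (2 * n + 1)).ne'
    have hg := Gamma_add_natCast_eq_poch (show (0 : ℝ) < 3 / 2 by norm_num) (2 * n + 1)
    have hG := Real.Gamma_nat_eq_factorial (2 * n + 2)
    have hg2 := Real.Gamma_add_one (s := 1 / 2) (by norm_num)
    rw [show (1 / 2 + 1 : ℝ) = 3 / 2 by norm_num, Real.Gamma_one_half_eq] at hg2
    push_cast at hg hG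
    rw [show (2 * n + 1 / 2 + 2 : ℝ) = 3 / 2 + (2 * n + 1) by ring, hg, hg2,
      show (2 * n + 2 * (1 / 2) + 2 : ℝ) = 2 * n + 2 + 1 by ring, hG,
      mul_pow, mul_pow, Real.sq_sqrt Real.pi_pos.le, Nat.factorial_succ]
    have hF := Nat.cast_ne_zero (R := ℝ).mpr (2 * n + 1).factorial_ne_zero
    have hn : (2 * n + 2 : ℝ) ≠ 0 := by positivity
    rw [show (2 : ℝ) ^ (2 * (1 / 2) + 1 : ℝ) = 4 by norm_num]
    push_cast
    rw [show (2 * n + 1 + 1 : ℝ) = 2 * n + 2 by ring]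
    field_simp
    norm_num
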